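/- Fix $k\ge 1$ outcomes and $T\ge 1$ rounds. In the $\ell_1$ calibration game, on each round $t=1,\dots,T$ the player chooses a probability distribution $q_t$ on the simplex $\Delta(k)\subset\mathbb{R}^k$, the adversary chooses a vertex $x_t\in\{e_1,\dots,e_k\}$ of $\Delta(k)$, and the player draws a forecast $f_t\sim q_t$; both sides observe $(f_t,x_t)$, and both may be randomized and adaptive. The regret is $$\mathrm{Reg}_T=\sup_{\lambda>0}\ \sup_{p\in\Delta(k)}\left\|\frac1T\sum_{t=1}^T \mathbf 1\{\|f_t-p\|_1\le\lambda\}\,(f_t-x_t)\right\|_1 ,$$ and for $\theta>0$ the value of the game is $$V_T^\theta=\inf_{q_1}\sup_{x_1}\mathbb E_{f_1\sim q_1}\cdots\inf_{q_T}\sup_{x_T}\mathbb E_{f_T\sim q_T}\ \mathbf 1\{\mathrm{Reg}_T>\theta\}.$$ **Theorem.** There is an absolute constant $c>0$ such that both of the following hold. 1. For all $k\ge1$, $T\ge 1$ and $\theta>3/T$, $$V_T^\theta\le 8\exp\left(-\frac{T(\theta/12)^2}{16k}+c\,k^3\log T\right).$$ 2. For all $k\ge1$, $T\ge3$ and $\eta\in(0,1)$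 there is a player strategy (giving each $q_t$ as a measurable function of the past moves $f_1,x_1,\dots,f_{t-1},x_{t-1}$) such that, against every adversary, with probability at least $1-\eta$, $$\mathrm{Reg}_T\le 48\sqrt{\frac{k\log(8/\eta)+c\,k^4\log T}{T}}\,.$$ -/

import Mathlib

open MeasureTheory ProbabilityTheory
open scoped ENNReal

namespace Calibration

/-- Moves of the player: the probability simplex in `ℝᵏ`. -/
abbrev Forecast (k : ℕ) : Type := stdSimplex ℝ (Fin k)

/-- One round of play `(f, x)`. The adversary's move, a vertex of the simplex, is recorded by
its index `x : Fin k`. -/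
abbrev Round (k : ℕ) : Type := Forecast k × Fin k

/-- The moves `(f₁, x₁), …, (f_t, x_t)` of the first `t` rounds. -/
abbrev History (k t : ℕ) : Type := Fin t → Round k

/-- The `ℓ₁` norm on `ℝᵏ`. -/
def l1norm {k : ℕ} (v : Fin k → ℝ) : ℝ := ∑ i, |v i|

/-- The standard unit vector of an outcome. -/
def vertex {k : ℕ} (x : Fin k) : Fin k → ℝ := Pi.single x 1

/-- The transformed payoff `𝟙{‖f - p‖₁ ≤ r} • (f - x)`. -/
noncomputable def payoff {k : ℕ} (r : ℝ) (p : Forecast k) (z : Round k) : Fin k → ℝ :=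
  if l1norm ((z.1 : Fin k → ℝ) - (p : Fin k → ℝ)) ≤ r then (z.1 : Fin k → ℝ) - vertex z.2 else 0

/-- `Reg_T = sup_{r > 0} sup_{p ∈ Δ(k)} ‖(1/T) ∑ₜ 𝟙{‖fₜ - p‖₁ ≤ r} (fₜ - xₜ)‖₁`. -/
noncomputable def regret {k T : ℕ} (h : History k T) : ℝ :=
  ⨆ a : {r : ℝ // 0 < r} × Forecast k,
    l1norm ((1 / (T : ℝ)) • ∑ t, payoff a.1.1 a.2 (h t))

/-- The minimax value
`inf_{q₁} sup_{x₁} E_{f₁ ∼ q₁} ⋯ inf_{q_T} sup_{x_T} E_{f_T ∼ q_T} L((f₁, x₁), …, (f_T, x_T))`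
of the `T`-round game with terminal loss `L`. -/
noncomputable def gameValue {k : ℕ} : (T : ℕ) → (History k T → ℝ≥0∞) → ℝ≥0∞
  | 0, L => L Fin.elim0
  | T + 1, L =>
      ⨅ q : ProbabilityMeasure (Forecast k), ⨆ x : Fin k,
        ∫⁻ f, gameValue T (fun h => L (Fin.cons (f, x) h)) ∂(q : Measure (Forecast k))

/-- The value `V_T^θ` of the calibration game: the terminal loss is `𝟙{Reg_T > θ}`. -/
noncomputable def thetaValue (k T : ℕ) (θ : ℝ) : ℝ≥0∞ :=
  gameValue T ({h : History k T | θ < regret h}.indicator 1)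

/-- A (randomized, adaptive) player strategy: at each round a mixed forecast which depends
measurably on the past moves. -/
structure PlayerStrategy (k : ℕ) where
  move : (t : ℕ) → Kernel (History k t) (Forecast k)
  markov : ∀ t, IsMarkovKernel (move t)

/-- A (randomized, adaptive) adversary strategy: at each round a distribution of the outcome
which depends measurably on the past moves. An adversary who also observes the mixed moves
of a given player strategy is of this form, as those are functions of the past moves. -/
structure AdversaryStrategy (k : ℕ) where
  move : (t : ℕ) → Kernel (History k t) (Fin k)
  markov : ∀ t, IsMarkovKernel (move t)

attribute [instance] PlayerStrategy.markov AdversaryStrategy.markov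

/-- The law of the first `t` rounds: given the past, the next `f` and `x` are drawn
independently from the two strategies. -/
noncomputable def law {k : ℕ} (π : PlayerStrategy k) (α : AdversaryStrategy k) :
    (t : ℕ) → Measure (History k t)
  | 0 => Measure.dirac Fin.elim0
  | t + 1 =>
      (law π α t ⊗ₘ (π.move t ×ₖ α.move t)).map
        (fun y : History k t × Round k => (Fin.snoc y.1 y.2 : History k (t + 1)))

theorem measurable_snoc (k t : ℕ) :
    Measurable (fun y : History k t × Round k => (Fin.snoc y.1 y.2 : History k (t + 1))) := by
  refine measurable_pi_lambda _ fun i => ?_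
  refine Fin.lastCases ?_ (fun j => ?_) i
  · simpa using measurable_snd
  · simpa using (show Measurable fun y : History k t × Round k => y.1 j from
      (measurable_pi_apply j).comp measurable_fst)

instance isProbabilityMeasure_law {k : ℕ} (π : PlayerStrategy k) (α : AdversaryStrategy k)
    (t : ℕ) : IsProbabilityMeasure (law π α t) := by
  induction t with
  | zero => unfold law; infer_instance
  | succ t ih =>
      unfold law
      exact Measure.isProbabilityMeasure_map (measurable_snoc k t).aemeasurable

/-- The supremum that defines the regret is that of a bounded family. -/
theorem regret_bddAbove {k T : ℕ} (h : History k T) :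
    BddAbove (Set.range fun a : {r : ℝ // 0 < r} × Forecast k =>
      l1norm ((1 / (T : ℝ)) • ∑ t, payoff a.1.1 a.2 (h t))) := by
  refine ⟨∑ i, (1 / (T : ℝ)) * ∑ t, |((h t).1 : Fin k → ℝ) i - vertex (h t).2 i|, ?_⟩
  rintro _ ⟨a, rfl⟩
  refine Finset.sum_le_sum fun i _ => ?_
  have hT : (0 : ℝ) ≤ 1 / (T : ℝ) := by positivity
  simp only [Pi.smul_apply, smul_eq_mul, abs_mul, abs_of_nonneg hT, Finset.sum_apply]
  refine mul_le_mul_of_nonneg_left ((Finset.abs_sum_le_sum_abs _ _).trans ?_) hT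
  refine Finset.sum_le_sum fun t _ => ?_
  unfold payoff
  split_ifs
  · simp
  · simp

end Calibration

/-!
The player forecasts points of a grid of spacing `1 / T` in the simplex and runs a multiplicative
weights argument against the experts `(A, σ)`, where `A` is the trace on the grid of an `ℓ₁` ball
and `σ` is a sign vector. The expert scores `𝟙{f ∈ A} ⟨σ, f - x⟩` in the round `(f, x)`. By the
definition of the `ℓ₁` norm, `Reg_T > θ` means that some expert has total score above `T θ`, so
that its weight `exp (η · score)` exceeds `exp (η T θ)`.

Against a known mixed outcome `m` a grid point within `2 k / T` of `m` gives every expert an average score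
of at most `2 k / T`, so the total weight grows at most by the factor
`K = exp (4 η² + 2 η k / T)` in expectation. By the minimax theorem for finite games there is a
mixed forecast with this property against every outcome, whatever the current weights
(`isContained_gain`). Iterating this bounds both the minimax value (`gameValue_le_of_le_sum_prod`)
and, through Markov's inequality, the tail of the regret of the resulting strategy
(`lintegral_potential_law_le`). The strategy is measurable because the weights take only finitely
many values (`exists_strategy_of_isContained`). With `η = θ / 8` the tail is at most
`N exp (-T θ² / 16 + O(k))`, where `N` is the number of experts.

It remains to see that `log N = O(k³ log T)`. Once the grid cell of the centre is fixed, membership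
in the ball is a linear inequality in `k + 2` features of the grid point, so the traces have
Vapnik-Chervonenkis dimension at most `k + 2`, and the Sauer-Shelah lemma bounds their number
(`card_ballTraces_le`). The second claim is this tail bound at the threshold `θ` for which it
equals the given failure probability; a threshold above `2` is trivial since the regret never exceeds `2`.
-/

namespace Calibration

/-! ### Finite zero-sum games -/

/-- The minimax theorem for a finite matrix game: if every mixed move of the column player has a
pure answer of value at most `ε`, then one mixed answer is good against all columns. -/
theorem exists_mixed_le_of_forall_exists_le {α β : Type*} [Fintype α] [Fintype β] [Nonempty β]
    (M : α → β → ℝ) (ε : ℝ)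
    (h : ∀ μ ∈ stdSimplex ℝ β, ∃ a, ∑ x, μ x * M a x ≤ ε) :
    ∃ q ∈ stdSimplex ℝ α, ∀ x, ∑ a, q a * M a x ≤ ε := by
  classical
  obtain ⟨x₀⟩ := ‹Nonempty β›
  obtain ⟨a₀, -⟩ := h _ (single_mem_stdSimplex ℝ x₀)
  obtain ⟨q, hq, μ, hμ, hs⟩ := Sion.exists_isSaddlePointOn
    (f := fun (q : α → ℝ) (μ : β → ℝ) => ∑ a, ∑ x, q a * (μ x * M a x))
    (X := stdSimplex ℝ α) (Y := stdSimplex ℝ β)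
    ⟨_, single_mem_stdSimplex ℝ a₀⟩ (convex_stdSimplex ℝ α) (isCompact_stdSimplex ℝ α)
    (fun y _ => Continuous.lowerSemicontinuous (by fun_prop) |>.lowerSemicontinuousOn _)
    (fun y _ => ConvexOn.quasiconvexOn ⟨convex_stdSimplex ℝ α, fun u _ v _ a b _ _ _ => le_of_eq (by
      simp only [Pi.add_apply, Pi.smul_apply, smul_eq_mul, add_mul, Finset.sum_add_distrib,
        Finset.mul_sum, mul_assoc])⟩)
    (convex_stdSimplex ℝ β) ⟨_, single_mem_stdSimplex ℝ x₀⟩ (isCompact_stdSimplex ℝ β)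
    (fun y _ => Continuous.upperSemicontinuous (by fun_prop) |>.upperSemicontinuousOn _)
    (fun y _ => ConcaveOn.quasiconcaveOn ⟨convex_stdSimplex ℝ β, fun u _ v _ a b _ _ _ =>
      le_of_eq (by
        simp only [Pi.add_apply, Pi.smul_apply, smul_eq_mul, add_mul, mul_add,
          Finset.sum_add_distrib, Finset.mul_sum, mul_assoc, mul_left_comm])⟩)
  obtain ⟨a, ha⟩ := h μ hμ
  refine ⟨q, hq, fun x => ?_⟩
  have := hs _ (single_mem_stdSimplex ℝ a) _ (single_mem_stdSimplex ℝ x)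
  simp only [Pi.single_apply, ite_mul, one_mul, zero_mul, mul_ite, mul_zero, Finset.sum_ite_eq',
    Finset.mem_univ, if_true] at this
  refine this.trans (le_trans (le_of_eq ?_) ha)
  rw [Finset.sum_comm]
  simp

/-! ### The potential method -/

section Potential

variable {k : ℕ} {ι : Type*} [Fintype ι]

/-- A family `g` of nonnegative gains of a round is `K`-contained if, however the members of the
family are weighted, the player has a mixed forecast for which the expected weighted gain is at
most `K` times the total weight, whatever the outcome. -/
def IsContained (g : ι → Round k → ℝ≥0∞) (K : ℝ≥0∞) : Prop :=
  ∀ w : ι → ℝ≥0∞, ∃ q : ProbabilityMeasure (Forecast k), ∀ x : Fin k,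
    ∫⁻ f, ∑ i, w i * g i (f, x) ∂(q : Measure (Forecast k)) ≤ K * ∑ i, w i

/-- The total weight after the history `h`, when the weights start at `1` and are multiplied by
the gains of every round. -/
noncomputable def potential (g : ι → Round k → ℝ≥0∞) {t : ℕ} (h : History k t) : ℝ≥0∞ :=
  ∑ i, ∏ s, g i (h s)

/-- By backward induction: when the first round `z` has been played, the weights `w` become `w * g z`.
No measurability of the loss is needed, since only upper bounds on integrals are used. -/
theorem gameValue_le_of_le_sum_prod {g : ι → Round k → ℝ≥0∞} {K : ℝ≥0∞}
    (hg : IsContained g K) (hK : K ≠ ∞) (T : ℕ) (w : ι → ℝ≥0∞) (L : History k T → ℝ≥0∞)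
    (hL : ∀ h, L h ≤ ∑ i, w i * ∏ s, g i (h s)) :
    gameValue T L ≤ K ^ T * ∑ i, w i := by
  induction T generalizing w with
  | zero => simpa [gameValue] using hL Fin.elim0
  | succ T ih =>
    obtain ⟨q, hq⟩ := hg w
    unfold gameValue
    refine iInf_le_of_le q (iSup_le fun x => ?_)
    calc ∫⁻ f, gameValue T (fun h => L (Fin.cons (f, x) h)) ∂(q : Measure (Forecast k))
        ≤ ∫⁻ f, K ^ T * ∑ i, w i * g i (f, x) ∂(q : Measure (Forecast k)) := by
          refine lintegral_mono fun f => ih _ _ fun h => (hL _).trans (le_of_eq ?_)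
          simp [Fin.prod_univ_succ, mul_assoc]
      _ ≤ K ^ T * ∫⁻ f, ∑ i, w i * g i (f, x) ∂(q : Measure (Forecast k)) := by
          rw [lintegral_const_mul' _ _ (ENNReal.pow_ne_top hK)]
      _ ≤ K ^ T * (K * ∑ i, w i) := by gcongr; exact hq x
      _ = K ^ (T + 1) * ∑ i, w i := by ring

theorem measurable_potential {g : ι → Round k → ℝ≥0∞} (hm : ∀ i, Measurable (g i)) (t : ℕ) :
    Measurable (potential g : History k t → ℝ≥0∞) := by
  unfold potential
  fun_prop

theorem potential_snoc (g : ι → Round k → ℝ≥0∞) {t : ℕ} (h : History k t) (z : Round k) :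
    potential g (Fin.snoc h z : History k (t + 1)) = ∑ i, (∏ s, g i (h s)) * g i z := by
  simp [potential, Fin.prod_univ_castSucc]

theorem lintegral_potential_snoc_le {g : ι → Round k → ℝ≥0∞} {K : ℝ≥0∞}
    (hm : ∀ i, Measurable (g i)) {t : ℕ} {h : History k t}
    {π : Kernel (History k t) (Forecast k)} [IsMarkovKernel π]
    {α : Kernel (History k t) (Fin k)} [IsMarkovKernel α]
    (hπ : ∀ x : Fin k, ∫⁻ f, ∑ i, (∏ s, g i (h s)) * g i (f, x) ∂(π h) ≤ K * potential g h) :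
    ∫⁻ z, potential g (Fin.snoc h z : History k (t + 1)) ∂((π ×ₖ α) h) ≤ K * potential g h := by
  simp only [potential_snoc]
  have hh : Measurable fun z => ∑ i, (∏ s, g i (h s)) * g i z := by fun_prop
  rw [Kernel.lintegral_prod_symm _ _ _ hh]
  calc ∫⁻ x, ∫⁻ f, ∑ i, (∏ s, g i (h s)) * g i (f, x) ∂(π h) ∂(α h)
      ≤ ∫⁻ _, K * potential g h ∂(α h) := lintegral_mono hπ
    _ = K * potential g h := by rw [lintegral_const, measure_univ, mul_one]

theorem lintegral_potential_law_le {g : ι → Round k → ℝ≥0∞} {K : ℝ≥0∞}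
    (hm : ∀ i, Measurable (g i)) (π : PlayerStrategy k)
    (hπ : ∀ t (h : History k t) (x : Fin k),
      ∫⁻ f, ∑ i, (∏ s, g i (h s)) * g i (f, x) ∂(π.move t h) ≤ K * potential g h)
    (α : AdversaryStrategy k) (t : ℕ) :
    ∫⁻ h, potential g h ∂(law π α t) ≤ K ^ t * Fintype.card ι := by
  induction t with
  | zero =>
    rw [law, lintegral_dirac' _ (measurable_potential hm 0)]
    simp [potential]
  | succ t ih =>
    have hm' : Measurable fun y : History k t × Round k =>
        potential g (Fin.snoc y.1 y.2 : History k (t + 1)) :=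
      (measurable_potential hm (t + 1)).comp (measurable_snoc k t)
    rw [law, lintegral_map (measurable_potential hm _) (measurable_snoc k t),
      Measure.lintegral_compProd hm']
    calc ∫⁻ h, ∫⁻ z, potential g (Fin.snoc h z : History k (t + 1))
            ∂((π.move t ×ₖ α.move t) h) ∂(law π α t)
        ≤ ∫⁻ h, K * potential g h ∂(law π α t) := by
          exact lintegral_mono fun h => lintegral_potential_snoc_le hm (hπ t h)
      _ = K * ∫⁻ h, potential g h ∂(law π α t) := lintegral_const_mul _ (measurable_potential hm t)
      _ ≤ K * (K ^ t * Fintype.card ι) := by gcongr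
      _ = K ^ (t + 1) * Fintype.card ι := by ring

/-- If the gains take finitely many values, then so do the weights after `t` rounds, and any choice
of a mixed forecast as a function of the weights is measurable. -/
theorem exists_strategy_of_isContained {g : ι → Round k → ℝ≥0∞} {K : ℝ≥0∞}
    (hg : IsContained g K) (hm : ∀ i, Measurable (g i))
    (hfin : (Set.range fun z i => g i z).Finite) :
    ∃ π : PlayerStrategy k, ∀ t (h : History k t) (x : Fin k),
      ∫⁻ f, ∑ i, (∏ s, g i (h s)) * g i (f, x) ∂(π.move t h) ≤ K * potential g h := by
  choose q hq using hg
  have hW : ∀ t, (Set.range fun (h : History k t) i => ∏ s, g i (h s)).Finite := by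
    intro t
    refine ((Set.Finite.pi' fun _ : Fin t => hfin).image
      fun v i => ∏ s, v s i).subset ?_
    rintro _ ⟨h, rfl⟩
    exact ⟨fun s i => g i (h s), fun s => ⟨h s, rfl⟩, rfl⟩
  have hWm : ∀ t, Measurable fun (h : History k t) i => ∏ s, g i (h s) := by
    intro t
    fun_prop
  let W (t : ℕ) : SimpleFunc (History k t) (ι → ℝ≥0∞) :=
    ⟨fun h i => ∏ s, g i (h s), fun w => hWm t (measurableSet_singleton w), hW t⟩
  refine ⟨⟨fun t => ⟨fun h => q (W t h),
      ((W t).map fun w => (q w : Measure (Forecast k))).measurable⟩,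
    fun t => ⟨fun h => (q (W t h)).2⟩⟩, fun t h x => hq _ x⟩

end Potential

/-! ### Counting the traces of `ℓ₁` balls -/

/-- A set family cut out by linear inequalities in the features `φ a ∈ V` shatters no set with more
than `dim V` points: a linear relation between the features of the points would give a subset,
that of the points with positive coefficient, which is not cut out. -/
theorem card_le_finrank_of_shatters {α V : Type*} [DecidableEq α] [AddCommGroup V] [Module ℝ V]
    [Module.Finite ℝ V] (φ : α → V) (S : Finset α) (𝒜 : Finset (Finset α))
    (h𝒜 : ∀ A ∈ 𝒜, ∃ ℓ : V →ₗ[ℝ] ℝ, ∀ a ∈ S, a ∈ A ↔ ℓ (φ a) ≤ 0)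
    {t : Finset α} (htS : t ⊆ S) (ht : 𝒜.Shatters t) : t.card ≤ Module.finrank ℝ V := by
  by_contra! hlt
  obtain ⟨c, hc, a₀, hne⟩ : ∃ c : t → ℝ, ∑ a, c a • φ a = 0 ∧ ∃ a, c a ≠ 0 := by
    refine Fintype.not_linearIndependent_iff.mp fun hli => ?_
    have := hli.fintype_card_le_finrank
    rw [Fintype.card_coe] at this
    omega
  -- Replacing `c` by `-c` if necessary, some coefficient is negative.
  obtain ⟨c, hc, a₀, hneg⟩ : ∃ c : t → ℝ, ∑ a, c a • φ a = 0 ∧ ∃ a, c a < 0 := by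
    rcases lt_or_gt_of_ne hne with h | h
    · exact ⟨c, hc, a₀, h⟩
    · exact ⟨fun a => -c a, by simpa using hc, a₀, by simpa using h⟩
  obtain ⟨A, hA, hAt⟩ := ht (t := (Finset.univ.filter fun a => 0 ≤ c a).map
    (Function.Embedding.subtype _)) (by
      intro a ha
      obtain ⟨b, -, rfl⟩ := Finset.mem_map.mp ha
      exact b.2)
  obtain ⟨ℓ, hℓ⟩ := h𝒜 A hA
  have key : ∀ a : t, 0 ≤ c a ↔ ℓ (φ a) ≤ 0 := by
    intro a
    rw [← hℓ a (htS a.2)]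
    have : (a : α) ∈ t ∩ A ↔ 0 ≤ c a := by
      rw [hAt]; simp
    rw [← this, Finset.mem_inter]
    exact ⟨fun h => h.2, fun h => ⟨a.2, h⟩⟩
  have hsum : ∑ a, c a * ℓ (φ a) = 0 := by
    have := congrArg ℓ hc
    simpa using this
  have hlt : ∑ a, c a * ℓ (φ a) < 0 := by
    refine Finset.sum_neg' (fun a _ => ?_) ⟨a₀, Finset.mem_univ _, ?_⟩
    · by_cases h : 0 ≤ c a
      · exact mul_nonpos_of_nonneg_of_nonpos h ((key a).1 h)
      · exact (mul_neg_of_neg_of_pos (not_le.1 h) (not_le.1 fun h' => h ((key a).2 h'))).le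
    · exact mul_neg_of_neg_of_pos hneg (not_le.1 fun h' => (not_le.2 hneg) ((key a₀).2 h'))
  exact hlt.ne hsum

/-- The Sauer-Shelah lemma for a set family cut out by linear inequalities in features. -/
theorem card_le_pow_of_linear {α V : Type*} [DecidableEq α] [AddCommGroup V] [Module ℝ V]
    [Module.Finite ℝ V] (φ : α → V) (S : Finset α) (𝒜 : Finset (Finset α))
    (hS : ∀ A ∈ 𝒜, A ⊆ S)
    (h𝒜 : ∀ A ∈ 𝒜, ∃ ℓ : V →ₗ[ℝ] ℝ, ∀ a ∈ S, a ∈ A ↔ ℓ (φ a) ≤ 0) :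
    𝒜.card ≤ (S.card + 1) ^ Module.finrank ℝ V := by
  set d := Module.finrank ℝ V
  have hsub : 𝒜.shatterer ⊆ (Finset.range (d + 1)).biUnion fun j => S.powersetCard j := by
    intro t ht
    have ht' := Finset.mem_shatterer.1 ht
    obtain ⟨A, hA, htA⟩ := ht'.exists_superset
    have htS := htA.trans (hS A hA)
    have := card_le_finrank_of_shatters φ S 𝒜 h𝒜 htS ht'
    simp only [Finset.mem_biUnion, Finset.mem_range, Finset.mem_powersetCard]
    exact ⟨_, Nat.lt_succ_of_le this, htS, rfl⟩
  calc 𝒜.card ≤ 𝒜.shatterer.card := Finset.card_le_card_shatterer 𝒜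
    _ ≤ _ := Finset.card_le_card hsub
    _ ≤ ∑ j ∈ Finset.range (d + 1), (S.powersetCard j).card := Finset.card_biUnion_le
    _ ≤ ∑ j ∈ Finset.range (d + 1), S.card ^ j * d.choose j := by
        refine Finset.sum_le_sum fun j hj => ?_
        rw [Finset.card_powersetCard]
        exact (Nat.choose_le_pow _ _).trans (Nat.le_mul_of_pos_right _
          (Nat.choose_pos (Nat.lt_succ_iff.1 (Finset.mem_range.1 hj))))
    _ = (S.card + 1) ^ d := by simp [add_pow]

/-- The points of the simplex whose coordinates are multiples of `1 / n`. -/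
noncomputable def grid (k n : ℕ) : Finset (Forecast k) := by
  classical
  exact Finset.subtype (· ∈ stdSimplex ℝ (Fin k))
    (Finset.univ.image fun (a : Fin k → Fin (n + 1)) i => ((a i : ℕ) : ℝ) / n)

theorem mem_grid {k n : ℕ} {f : Forecast k} :
    f ∈ grid k n ↔ ∃ a : Fin k → Fin (n + 1), ∀ i, (f : Fin k → ℝ) i = ((a i : ℕ) : ℝ) / n := by
  classical
  simp only [grid, Finset.mem_subtype, Finset.mem_image, Finset.mem_univ, true_and]
  exact exists_congr fun a => ⟨fun h i => (congrFun h i).symm, fun h => funext fun i => (h i).symm⟩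

theorem card_grid_le (k n : ℕ) : (grid k n).card ≤ (n + 1) ^ k := by
  classical
  rw [grid, Finset.card_subtype]
  refine (Finset.card_filter_le _ _).trans (Finset.card_image_le.trans ?_)
  simp

open scoped Classical in
/-- The trace on the grid of the `ℓ₁` ball with centre `p` and radius `r`. -/
noncomputable def ballTrace {k : ℕ} (n : ℕ) (p : Forecast k) (r : ℝ) : Finset (Forecast k) :=
  (grid k n).filter fun f => l1norm ((f : Fin k → ℝ) - (p : Fin k → ℝ)) ≤ r

open scoped Classical in
/-- All traces of `ℓ₁` balls on the grid. -/
noncomputable def ballTraces (k n : ℕ) : Finset (Finset (Forecast k)) :=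
  (grid k n).powerset.filter fun A => ∃ p r, A = ballTrace n p r

theorem ballTrace_mem_ballTraces {k n : ℕ} (p : Forecast k) (r : ℝ) :
    ballTrace n p r ∈ ballTraces k n := by
  classical
  simp only [ballTraces, Finset.mem_filter, Finset.mem_powerset]
  exact ⟨Finset.filter_subset _ _, p, r, rfl⟩

theorem natCast_div_le_iff_le_floor {n m : ℕ} (hn : 0 < n) {x : ℝ} (hx : 0 ≤ x) :
    (m : ℝ) / n ≤ x ↔ m ≤ ⌊(n : ℝ) * x⌋₊ := by
  have hn' : (0 : ℝ) < n := by exact_mod_cast hn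
  rw [Nat.le_floor_iff (by positivity), div_le_iff₀ hn', mul_comm]

/-- Once the cell `⌊n pᵢ⌋` of the centre is fixed, the signs of `pᵢ - fᵢ` are the same for all
centres, so `‖f - p‖₁ ≤ r` is a linear inequality in `k + 2` features of `f`. -/
theorem card_ballTraces_le {k n : ℕ} (hn : 0 < n) :
    (ballTraces k n).card ≤ (n + 1) ^ k * ((n + 1) ^ k + 1) ^ (k + 2) := by
  classical
  have hn' : (0 : ℝ) < n := by exact_mod_cast hn
  let 𝒜 (b : Fin k → Fin (n + 1)) : Finset (Finset (Forecast k)) :=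
    (grid k n).powerset.filter fun A => ∃ p r, A = ballTrace n p r ∧
      ∀ i, ⌊(n : ℝ) * (p : Fin k → ℝ) i⌋₊ = b i
  have hsub : ballTraces k n ⊆ Finset.univ.biUnion 𝒜 := by
    intro A hA
    simp only [ballTraces, Finset.mem_filter] at hA
    obtain ⟨hA, p, r, rfl⟩ := hA
    have hp : ∀ i, ⌊(n : ℝ) * (p : Fin k → ℝ) i⌋₊ < n + 1 := by
      intro i
      rw [Nat.lt_succ_iff]
      refine Nat.floor_le_of_le ?_
      have : (p : Fin k → ℝ) i ≤ 1 := (mem_Icc_of_mem_stdSimplex p.2 i).2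
      nlinarith
    simp only [Finset.mem_biUnion, Finset.mem_univ, true_and, 𝒜, Finset.mem_filter]
    exact ⟨fun i => ⟨_, hp i⟩, hA, p, r, rfl, fun i => rfl⟩
  have hcell : ∀ b, (𝒜 b).card ≤ ((n + 1) ^ k + 1) ^ (k + 2) := by
    intro b
    let s (f : Forecast k) (i : Fin k) : ℝ :=
      if (f : Fin k → ℝ) i ≤ ((b i : ℕ) : ℝ) / n then 1 else -1
    have hlin := card_le_pow_of_linear
      (fun f : Forecast k => ((s f, 1, ∑ i, s f i * (f : Fin k → ℝ) i) : (Fin k → ℝ) × ℝ × ℝ))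
      (grid k n) (𝒜 b) (fun A hA => Finset.mem_powerset.1 (Finset.mem_filter.1 hA).1) (by
        intro A hA
        obtain ⟨-, p, r, rfl, hb⟩ := Finset.mem_filter.1 hA
        refine ⟨(Fintype.linearCombination ℝ (p : Fin k → ℝ)).coprod
          (((-r) • LinearMap.id).coprod (-LinearMap.id)), fun f hf => ?_⟩
        have habs : l1norm ((f : Fin k → ℝ) - (p : Fin k → ℝ))
            = ∑ i, s f i * (p : Fin k → ℝ) i - ∑ i, s f i * (f : Fin k → ℝ) i := by
          rw [← Finset.sum_sub_distrib]
          refine Finset.sum_congr rfl fun i _ => ?_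
          obtain ⟨a, ha⟩ := mem_grid.1 hf
          have h1 : (f : Fin k → ℝ) i ≤ (p : Fin k → ℝ) i ↔
              (f : Fin k → ℝ) i ≤ ((b i : ℕ) : ℝ) / n := by
            rw [ha i, natCast_div_le_iff_le_floor hn (stdSimplex.zero_le p i), hb i,
              div_le_div_iff_of_pos_right hn', Nat.cast_le]
          simp only [Pi.sub_apply, s]
          split_ifs with h
          · rw [abs_of_nonpos (by linarith [h1.2 h])]; ring
          · rw [abs_of_nonneg (by linarith [not_le.1 (mt h1.1 h)])]; ring
        simp only [ballTrace, Finset.mem_filter, hf, true_and, habs]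
        simp only [LinearMap.coprod_apply, Fintype.linearCombination_apply, smul_eq_mul,
          LinearMap.smul_apply, LinearMap.id_apply, LinearMap.neg_apply]
        constructor <;> intro h <;> linarith)
    have hfr : Module.finrank ℝ ((Fin k → ℝ) × ℝ × ℝ) = k + 2 := by simp
    rw [hfr] at hlin
    exact hlin.trans (Nat.pow_le_pow_left (Nat.succ_le_succ (card_grid_le k n)) _)
  calc (ballTraces k n).card ≤ _ := Finset.card_le_card hsub
    _ ≤ ∑ b, (𝒜 b).card := Finset.card_biUnion_le
    _ ≤ ∑ _b : Fin k → Fin (n + 1), ((n + 1) ^ k + 1) ^ (k + 2) :=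
        Finset.sum_le_sum fun b _ => hcell b
    _ = _ := by simp

/-! ### The `ℓ₁` norm as a maximum over sign vectors -/

/-- The linear functional `v ↦ ∑ i, ± v i`, with sign `+` where `σ i` is true. -/
noncomputable def signedSum {k : ℕ} (σ : Fin k → Bool) : (Fin k → ℝ) →ₗ[ℝ] ℝ :=
  ∑ i, (if σ i then (1 : ℝ) else -1) • LinearMap.proj i

theorem signedSum_apply {k : ℕ} (σ : Fin k → Bool) (v : Fin k → ℝ) :
    signedSum σ v = ∑ i, (if σ i then (1 : ℝ) else -1) * v i := by
  simp only [signedSum, LinearMap.sum_apply, LinearMap.smul_apply, LinearMap.proj_apply, smul_eq_mul]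

theorem abs_signedSum_le {k : ℕ} (σ : Fin k → Bool) (v : Fin k → ℝ) :
    |signedSum σ v| ≤ l1norm v := by
  rw [signedSum_apply]
  refine (Finset.abs_sum_le_sum_abs _ _).trans (Finset.sum_le_sum fun i _ => ?_)
  split_ifs <;> simp

theorem exists_signedSum_eq_l1norm {k : ℕ} (v : Fin k → ℝ) : ∃ σ, signedSum σ v = l1norm v := by
  refine ⟨fun i => decide (0 ≤ v i), ?_⟩
  rw [signedSum_apply]
  refine Finset.sum_congr rfl fun i _ => ?_
  by_cases h : 0 ≤ v i
  · simp [h, abs_of_nonneg h]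
  · simp [h, abs_of_neg (not_le.1 h)]

theorem l1norm_nonneg {k : ℕ} (v : Fin k → ℝ) : 0 ≤ l1norm v :=
  Finset.sum_nonneg fun _ _ => abs_nonneg _

theorem l1norm_sub_vertex_le {k : ℕ} (f : Forecast k) (x : Fin k) :
    l1norm ((f : Fin k → ℝ) - vertex x) ≤ 2 := by
  calc l1norm ((f : Fin k → ℝ) - vertex x)
      ≤ ∑ i, ((f : Fin k → ℝ) i + vertex x i) := by
        refine Finset.sum_le_sum fun i _ => (abs_sub _ _).trans (le_of_eq ?_)
        have h : 0 ≤ vertex x i := by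
          unfold vertex
          rw [Pi.single_apply]
          split_ifs <;> norm_num
        rw [abs_of_nonneg (stdSimplex.zero_le f i), abs_of_nonneg h]
    _ = 2 := by
        rw [Finset.sum_add_distrib, stdSimplex.sum_eq_one]
        simp [vertex]
        norm_num

theorem sum_smul_sub_vertex {k : ℕ} (f m : Forecast k) :
    ∑ x, (m : Fin k → ℝ) x • ((f : Fin k → ℝ) - vertex x)
      = (f : Fin k → ℝ) - (m : Fin k → ℝ) := by
  simp only [smul_sub, Finset.sum_sub_distrib, ← Finset.sum_smul, stdSimplex.sum_eq_one, one_smul]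
  congr 1
  ext i
  simp [vertex, Pi.single_apply]

/-- The coordinates are rounded down to multiples of `1 / n`, and the missing mass, less than
`k / n`, is put on one coordinate. -/
theorem exists_mem_grid_l1norm_sub_le {k n : ℕ} (hk : 0 < k) (hn : 0 < n) (m : Forecast k) :
    ∃ f ∈ grid k n, l1norm ((f : Fin k → ℝ) - (m : Fin k → ℝ)) ≤ 2 * k / n := by
  have hn' : (0 : ℝ) < n := by exact_mod_cast hn
  let i₀ : Fin k := ⟨0, hk⟩
  let a (i : Fin k) : ℕ := ⌊(n : ℝ) * m i⌋₊
  have ha : ∀ i, (a i : ℝ) ≤ n * m i := fun i =>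
    Nat.floor_le (mul_nonneg hn'.le (stdSimplex.zero_le m i))
  have ha' : ∀ i, n * m i - 1 ≤ (a i : ℝ) := fun i => (Nat.sub_one_lt_floor _).le
  have hsum : ∑ i, (n * m i : ℝ) = n := by
    rw [← Finset.mul_sum, stdSimplex.sum_eq_one, mul_one]
  have hle : ∑ i, a i ≤ n := by
    have : ∑ i, (a i : ℝ) ≤ n := (Finset.sum_le_sum fun i _ => ha i).trans_eq hsum
    exact_mod_cast this
  obtain ⟨d, hd⟩ := Nat.exists_eq_add_of_le hle
  have hdk : (d : ℝ) ≤ k := by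
    have h1 : ∑ i : Fin k, (n * m i - 1 : ℝ) ≤ ∑ i, (a i : ℝ) := Finset.sum_le_sum fun i _ => ha' i
    rw [Finset.sum_sub_distrib, hsum] at h1
    have h2 : (n : ℝ) = ∑ i, (a i : ℝ) + d := by exact_mod_cast hd
    simp at h1
    linarith
  let b (i : Fin k) : ℕ := a i + if i = i₀ then d else 0
  have hb : ∑ i, b i = n := by simp [b, Finset.sum_add_distrib, hd]
  have hbn : ∀ i, b i < n + 1 := fun i => Nat.lt_succ_of_le
    ((Finset.single_le_sum (fun j _ => Nat.zero_le (b j)) (Finset.mem_univ i)).trans_eq hb)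
  refine ⟨⟨fun i => (b i : ℝ) / n, fun i => by positivity, ?_⟩, ?_, ?_⟩
  · rw [← Finset.sum_div, ← Nat.cast_sum, hb, div_self hn'.ne']
  · exact mem_grid.2 ⟨fun i => ⟨b i, hbn i⟩, fun i => rfl⟩
  · have hi : ∀ i, |(b i : ℝ) / n - m i| ≤ 1 / n + (if i = i₀ then (d : ℝ) else 0) / n := by
      intro i
      have h0 : (0 : ℝ) ≤ if i = i₀ then (d : ℝ) else 0 := by split_ifs <;> positivity
      have hbi : (b i : ℝ) = a i + if i = i₀ then (d : ℝ) else 0 := by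
        simp only [b]; push_cast; rfl
      rw [← add_div, le_div_iff₀ hn', ← abs_of_pos hn', ← abs_mul, abs_of_pos hn', sub_mul,
        div_mul_cancel₀ _ hn'.ne', hbi, abs_le]
      constructor <;> linarith [ha i, ha' i]
    calc _ ≤ ∑ i : Fin k, (1 / (n : ℝ) + (if i = i₀ then (d : ℝ) else 0) / n) :=
          Finset.sum_le_sum fun i _ => hi i
      _ = k / n + d / n := by
          rw [Finset.sum_add_distrib, ← Finset.sum_div]
          simp [div_eq_mul_inv]
      _ ≤ k / n + k / n := by gcongr
      _ = 2 * k / n := by ring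

/-! ### Exponential gains -/

/-- The experts: a trace `A` of an `ℓ₁` ball on the grid together with a sign vector. -/
abbrev Expert (k n : ℕ) : Type := ballTraces k n × (Fin k → Bool)

open scoped Classical in
/-- The payoff `𝟙{f ∈ A} ∑ i, σ i (f i - x i)` of the expert `(A, σ)` in the round `(f, x)`. -/
noncomputable def Expert.score {k n : ℕ} (e : Expert k n) (z : Round k) : ℝ :=
  if z.1 ∈ e.1.1 then signedSum e.2 ((z.1 : Fin k → ℝ) - vertex z.2) else 0

open scoped Classical in
/-- The factor by which the weight of an expert grows in a round. It is infinite for forecasts off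
the grid: this makes the potential infinite as soon as one such forecast has been made, so that
no separate argument is needed to exclude them. -/
noncomputable def Expert.gain {k n : ℕ} (η : ℝ) (e : Expert k n) (z : Round k) : ℝ≥0∞ :=
  if z.1 ∈ grid k n then ENNReal.ofReal (Real.exp (η * e.score z)) else ∞

theorem Expert.abs_score_le {k n : ℕ} (e : Expert k n) (z : Round k) : |e.score z| ≤ 2 := by
  unfold Expert.score
  split_ifs
  · exact (abs_signedSum_le _ _).trans (l1norm_sub_vertex_le _ _)
  · simp

theorem Expert.sum_mul_score_le {k n : ℕ} (e : Expert k n) (f m : Forecast k) :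
    ∑ x, m x * e.score (f, x) ≤ l1norm ((f : Fin k → ℝ) - (m : Fin k → ℝ)) := by
  by_cases h : f ∈ e.1.1
  · simp only [Expert.score, h, if_true]
    rw [← sum_smul_sub_vertex]
    refine le_trans (le_of_eq ?_) ((le_abs_self _).trans (abs_signedSum_le e.2 _))
    simp only [map_sum, map_smul, smul_eq_mul]
  · simpa [Expert.score, h] using l1norm_nonneg _

theorem Expert.sum_mul_exp_score_le {k n : ℕ} {η : ℝ} (hη : 0 ≤ η) (hη' : η ≤ 1 / 2)
    (e : Expert k n) {f m : Forecast k} {δ : ℝ}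
    (hf : l1norm ((f : Fin k → ℝ) - (m : Fin k → ℝ)) ≤ δ) :
    ∑ x, m x * Real.exp (η * e.score (f, x)) ≤ Real.exp (4 * η ^ 2 + η * δ) := by
  have hexp : ∀ x, Real.exp (η * e.score (f, x)) ≤ 1 + 4 * η ^ 2 + η * e.score (f, x) := by
    intro x
    have hs := abs_le.1 (e.abs_score_le (f, x))
    have h1 : |η * e.score (f, x)| ≤ 1 := by
      rw [abs_le]; constructor <;> nlinarith
    have h2 := Real.norm_exp_sub_one_sub_id_le (x := η * e.score (f, x)) h1
    rw [Real.norm_eq_abs, Real.norm_eq_abs, sq_abs] at h2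
    have h3 : (η * e.score (f, x)) ^ 2 ≤ 4 * η ^ 2 := by
      have : e.score (f, x) ^ 2 ≤ 4 := by nlinarith
      rw [mul_pow]; nlinarith [sq_nonneg η]
    linarith [(abs_le.1 h2).2]
  calc ∑ x, m x * Real.exp (η * e.score (f, x))
      ≤ ∑ x, m x * (1 + 4 * η ^ 2 + η * e.score (f, x)) :=
        Finset.sum_le_sum fun x _ => mul_le_mul_of_nonneg_left (hexp x) (stdSimplex.zero_le m x)
    _ = 1 + 4 * η ^ 2 + η * ∑ x, m x * e.score (f, x) := by
        simp only [mul_add _ _ (η * _), Finset.sum_add_distrib, ← Finset.sum_mul,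
          stdSimplex.sum_eq_one, one_mul, Finset.mul_sum, mul_left_comm]
    _ ≤ 1 + 4 * η ^ 2 + η * δ := by gcongr; exact (e.sum_mul_score_le f m).trans hf
    _ ≤ Real.exp (4 * η ^ 2 + η * δ) := by
        linarith [Real.add_one_le_exp (4 * η ^ 2 + η * δ)]

theorem Expert.measurable_gain {k n : ℕ} (η : ℝ) (e : Expert k n) : Measurable (e.gain η) := by
  classical
  have hfst : ∀ A : Finset (Forecast k), MeasurableSet {z : Round k | z.1 ∈ A} := fun A =>
    measurable_fst A.measurableSet
  have hsum : Measurable fun z : Round k => signedSum e.2 ((z.1 : Fin k → ℝ) - vertex z.2) := by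
    simp only [signedSum_apply, Pi.sub_apply]
    refine Finset.measurable_sum _ fun i _ => Measurable.const_mul (Measurable.sub ?_ ?_) _
    · exact (measurable_pi_apply i).comp (measurable_subtype_coe.comp measurable_fst)
    · exact (Measurable.of_discrete (f := fun x : Fin k => vertex x i)).comp measurable_snd
  have hscore : Measurable e.score := Measurable.ite (hfst _) hsum measurable_const
  exact Measurable.ite (hfst _)
    (ENNReal.measurable_ofReal.comp (Real.measurable_exp.comp (hscore.const_mul η)))
    measurable_const

theorem Expert.finite_range_gain {k n : ℕ} (η : ℝ) :
    (Set.range fun (z : Round k) (e : Expert k n) => e.gain η z).Finite := by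
  classical
  refine ((((grid k n) ×ˢ (Finset.univ : Finset (Fin k))).finite_toSet.image
    fun (z : Round k) (e : Expert k n) => e.gain η z).insert fun _ => ∞).subset ?_
  rintro _ ⟨z, rfl⟩
  by_cases hz : z.1 ∈ grid k n
  · exact Or.inr ⟨z, by simpa using hz, rfl⟩
  · exact Or.inl (funext fun e => if_neg hz)

/-- Against a mixed outcome `m` the player answers with a grid point near `m`, for which the score
of every expert is small on average; the minimax theorem turns these answers into a mixed
forecast that is good against every outcome. -/
theorem isContained_gain {k n : ℕ} (hk : 0 < k) (hn : 0 < n) {η : ℝ} (hη : 0 ≤ η)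
    (hη' : η ≤ 1 / 2) :
    IsContained (fun e : Expert k n => e.gain η)
      (ENNReal.ofReal (Real.exp (4 * η ^ 2 + η * (2 * k / n)))) := by
  classical
  intro w
  have : Nonempty (Fin k) := ⟨⟨0, hk⟩⟩
  set K := Real.exp (4 * η ^ 2 + η * (2 * k / n))
  have hK : 0 ≤ K := (Real.exp_pos _).le
  -- If some weight is infinite, the right-hand side is infinite and every forecast will do.
  by_cases hw : ∃ e, w e = ∞
  · obtain ⟨e, he⟩ := hw
    obtain ⟨p⟩ : Nonempty (Forecast k) := inferInstance
    refine ⟨⟨Measure.dirac p, inferInstance⟩, fun x => le_top.trans_eq ?_⟩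
    rw [ENNReal.sum_eq_top.2 ⟨e, Finset.mem_univ _, he⟩, ENNReal.mul_top]
    simpa using Real.exp_pos _
  push Not at hw
  lift w to Expert k n → NNReal using hw
  obtain ⟨q, hq, hqx⟩ := exists_mixed_le_of_forall_exists_le
    (fun (f : grid k n) (x : Fin k) => ∑ e : Expert k n, (w e : ℝ) * Real.exp (η * e.score (f, x)))
    (K * ∑ e, (w e : ℝ)) (by
      intro μ hμ
      obtain ⟨f, hf, hfm⟩ := exists_mem_grid_l1norm_sub_le hk hn ⟨μ, hμ⟩
      refine ⟨⟨f, hf⟩, ?_⟩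
      simp only [Finset.mul_sum]
      rw [Finset.sum_comm]
      refine Finset.sum_le_sum fun e _ => ?_
      have := mul_le_mul_of_nonneg_left (e.sum_mul_exp_score_le hη hη' hfm) (w e).coe_nonneg
      rw [mul_comm K]
      refine le_trans (le_of_eq ?_) this
      rw [Finset.mul_sum]
      exact Finset.sum_congr rfl fun x _ => mul_left_comm _ _ _)
  let Q : Measure (Forecast k) := ∑ f : grid k n, ENNReal.ofReal (q f) • Measure.dirac f.1
  have hQ : ∀ F : Forecast k → ℝ≥0∞,
      ∫⁻ f, F f ∂Q = ∑ f : grid k n, ENNReal.ofReal (q f) * F f := by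
    intro F
    simp only [Q, lintegral_finsetSum_measure, lintegral_smul_measure, lintegral_dirac,
      smul_eq_mul]
  have hQ1 : IsProbabilityMeasure Q := by
    refine ⟨?_⟩
    rw [← lintegral_one, hQ]
    simp only [mul_one]
    rw [← ENNReal.ofReal_sum_of_nonneg fun f _ => hq.1 f, hq.2, ENNReal.ofReal_one]
  refine ⟨⟨Q, hQ1⟩, fun x => ?_⟩
  change ∫⁻ f, _ ∂Q ≤ _
  rw [hQ]
  have hreal : ∀ f : grid k n, ∑ e : Expert k n, (w e : ℝ≥0∞) * e.gain η (f.1, x)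
      = ENNReal.ofReal (∑ e : Expert k n, (w e : ℝ) * Real.exp (η * e.score (f.1, x))) := by
    intro f
    rw [ENNReal.ofReal_sum_of_nonneg fun e _ => by positivity]
    refine Finset.sum_congr rfl fun e _ => ?_
    rw [ENNReal.ofReal_mul (w e).coe_nonneg, ENNReal.ofReal_coe_nnreal, Expert.gain, if_pos f.2]
  calc ∑ f : grid k n, ENNReal.ofReal (q f) * ∑ e : Expert k n, (w e : ℝ≥0∞) * e.gain η (f.1, x)
      = ENNReal.ofReal (∑ f : grid k n,
          q f * ∑ e : Expert k n, (w e : ℝ) * Real.exp (η * e.score (f.1, x))) := by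
        rw [ENNReal.ofReal_sum_of_nonneg fun f _ => mul_nonneg (hq.1 f) (by positivity)]
        refine Finset.sum_congr rfl fun f _ => ?_
        rw [hreal, ENNReal.ofReal_mul (hq.1 f)]
    _ ≤ ENNReal.ofReal (K * ∑ e, (w e : ℝ)) := ENNReal.ofReal_le_ofReal (hqx x)
    _ = ENNReal.ofReal K * ∑ e, (w e : ℝ≥0∞) := by
        rw [ENNReal.ofReal_mul hK,
          ENNReal.ofReal_sum_of_nonneg fun e _ => by positivity]
        simp only [ENNReal.ofReal_coe_nnreal]

/-! ### Large regret forces a large potential -/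

theorem l1norm_payoff_le {k : ℕ} (r : ℝ) (p : Forecast k) (z : Round k) :
    l1norm (payoff r p z) ≤ 2 := by
  unfold payoff
  split_ifs
  · exact l1norm_sub_vertex_le _ _
  · simp [l1norm]

theorem exists_sum_signedSum_payoff_eq {k T : ℕ} (h : History k T) (r : ℝ) (p : Forecast k) :
    ∃ σ, (1 / (T : ℝ)) * ∑ t, signedSum σ (payoff r p (h t))
      = l1norm ((1 / (T : ℝ)) • ∑ t, payoff r p (h t)) := by
  obtain ⟨σ, hσ⟩ := exists_signedSum_eq_l1norm ((1 / (T : ℝ)) • ∑ t, payoff r p (h t))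
  exact ⟨σ, by rw [← hσ, map_smul, map_sum, smul_eq_mul]⟩

theorem regret_le_two {k T : ℕ} (h : History k T) : regret h ≤ 2 := by
  refine Real.iSup_le (fun a => ?_) zero_le_two
  obtain ⟨σ, hσ⟩ := exists_sum_signedSum_payoff_eq h a.1.1 a.2
  rw [← hσ]
  calc (1 / (T : ℝ)) * ∑ t, signedSum σ (payoff a.1.1 a.2 (h t))
      ≤ (1 / (T : ℝ)) * ∑ _t : Fin T, 2 := by
        gcongr with t
        exact (le_abs_self _).trans ((abs_signedSum_le _ _).trans (l1norm_payoff_le _ _ _))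
    _ ≤ 2 := by
        rcases T.eq_zero_or_pos with rfl | hT
        · simp
        · have : (T : ℝ) ≠ 0 := by positivity
          simp [this]

theorem Expert.gain_ne_zero {k n : ℕ} (η : ℝ) (e : Expert k n) (z : Round k) :
    e.gain η z ≠ 0 := by
  unfold Expert.gain
  split_ifs
  · simpa using Real.exp_pos _
  · simp

theorem ofReal_exp_le_potential_of_lt_regret {k n T : ℕ} (hk : 0 < k) (hT : 0 < T) {η θ : ℝ}
    (hη : 0 ≤ η) {h : History k T} (hθ : θ < regret h) :
    ENNReal.ofReal (Real.exp (η * (T * θ))) ≤ potential (fun e : Expert k n => e.gain η) h := by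
  classical
  have : Nonempty (Fin k) := ⟨⟨0, hk⟩⟩
  have : Nonempty ({r : ℝ // 0 < r} × Forecast k) := ⟨⟨1, one_pos⟩, Classical.arbitrary _⟩
  obtain ⟨⟨⟨r, _⟩, p⟩, hrp⟩ := exists_lt_of_lt_ciSup hθ
  obtain ⟨σ, hσ⟩ := exists_sum_signedSum_payoff_eq h r p
  rw [← hσ, one_div, inv_mul_eq_div, lt_div_iff₀ (by positivity), mul_comm] at hrp
  let e : Expert k n := (⟨ballTrace n p r, ballTrace_mem_ballTraces p r⟩, σ)
  refine le_trans ?_ (Finset.single_le_sum (f := fun e : Expert k n => ∏ s, e.gain η (h s))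
    (fun _ _ => zero_le) (Finset.mem_univ e))
  by_cases hgrid : ∀ s, (h s).1 ∈ grid k n
  · have hscore : ∀ s, e.score (h s) = signedSum σ (payoff r p (h s)) := by
      intro s
      simp only [Expert.score, e, payoff, ballTrace, Finset.mem_filter, hgrid s, true_and]
      split_ifs <;> simp
    have hprod : ∏ s, e.gain η (h s) = ENNReal.ofReal (Real.exp (η * ∑ s, e.score (h s))) := by
      rw [Finset.mul_sum, Real.exp_sum, ENNReal.ofReal_prod_of_nonneg fun _ _ => (Real.exp_pos _).le]
      exact Finset.prod_congr rfl fun s _ => if_pos (hgrid s)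
    rw [hprod]
    refine ENNReal.ofReal_le_ofReal (Real.exp_le_exp.2 (mul_le_mul_of_nonneg_left ?_ hη))
    simp only [hscore]
    exact hrp.le
  · push Not at hgrid
    obtain ⟨s, hs⟩ := hgrid
    have htop : ∏ s, e.gain η (h s) = ∞ := by
      rw [← Finset.mul_prod_erase _ _ (Finset.mem_univ s), Expert.gain, if_neg hs, ENNReal.top_mul]
      exact Finset.prod_ne_zero_iff.2 fun t _ => e.gain_ne_zero η _
    rw [htop]
    exact le_top

theorem one_le_mul_potential_of_lt_regret {k n T : ℕ} (hk : 0 < k) (hT : 0 < T) {η θ : ℝ}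
    (hη : 0 ≤ η) {h : History k T} (hθ : θ < regret h) :
    1 ≤ ENNReal.ofReal (Real.exp (-(η * (T * θ)))) *
      potential (fun e : Expert k n => e.gain η) h := by
  calc (1 : ℝ≥0∞) = ENNReal.ofReal (Real.exp (-(η * (T * θ)))) *
        ENNReal.ofReal (Real.exp (η * (T * θ))) := by
        rw [← ENNReal.ofReal_mul (Real.exp_pos _).le, ← Real.exp_add]; simp
    _ ≤ _ := by
        gcongr
        exact ofReal_exp_le_potential_of_lt_regret hk hT hη hθ

/-! ### The bound on the tail of the regret -/

theorem card_expert_le {k T : ℕ} (hk : 1 ≤ k) (hT : 2 ≤ T) :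
    Fintype.card (Expert k T) ≤ T ^ (2 * k ^ 2 + 7 * k) := by
  have h1 : T + 1 ≤ T ^ 2 := by nlinarith
  have h2 : (T + 1) ^ k + 1 ≤ T ^ (2 * k) := by
    have hpow : (T + 1) ^ k + 1 ≤ (T + 2) ^ k := Nat.pow_lt_pow_left (by omega) (by omega)
    rw [pow_mul]
    exact hpow.trans (Nat.pow_le_pow_left (by nlinarith) _)
  calc Fintype.card (Expert k T) = (ballTraces k T).card * 2 ^ k := by simp [Expert]
    _ ≤ ((T + 1) ^ k * ((T + 1) ^ k + 1) ^ (k + 2)) * 2 ^ k := by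
        gcongr; exact card_ballTraces_le (by omega)
    _ ≤ ((T ^ 2) ^ k * (T ^ (2 * k)) ^ (k + 2)) * T ^ k := by gcongr
    _ = T ^ (2 * k ^ 2 + 7 * k) := by ring

/-- With grid spacing `1 / T` and learning rate `θ / 8` the `K ^ T` growth of the potential, the
number of experts and the threshold `exp (θ² T / 8)` combine to the claimed tail. -/
theorem growth_mul_card_mul_exp_le {k T : ℕ} (hk : 1 ≤ k) (hT : 2 ≤ T) {θ : ℝ} (hθ : 0 < θ)
    (hθ' : θ ≤ 2) :
    ENNReal.ofReal (Real.exp (4 * (θ / 8) ^ 2 + θ / 8 * (2 * k / T))) ^ T *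
        (Fintype.card (Expert k T) * ENNReal.ofReal (Real.exp (-(θ / 8 * (T * θ))))) ≤
      ENNReal.ofReal (8 * Real.exp
        (-((T : ℝ) * (θ / 12) ^ 2 / (16 * (k : ℝ))) + 10 * (k : ℝ) ^ 3 * Real.log T)) := by
  have hT0 : (0 : ℝ) < T := by positivity
  have hk1 : (1 : ℝ) ≤ k := by exact_mod_cast hk
  have hcard : (Fintype.card (Expert k T) : ℝ) ≤
      Real.exp ((2 * (k : ℝ) ^ 2 + 7 * k) * Real.log T) := by
    have : (Fintype.card (Expert k T) : ℝ) ≤ (T : ℝ) ^ (2 * k ^ 2 + 7 * k) := by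
      exact_mod_cast card_expert_le hk hT
    refine this.trans (le_of_eq ?_)
    rw [← Real.exp_log (pow_pos hT0 (2 * k ^ 2 + 7 * k)), Real.log_pow]
    push_cast
    rfl
  have hlog : 1 / 2 ≤ Real.log T := by
    have h2 : Real.log 2 ≤ Real.log T := Real.log_le_log two_pos (by exact_mod_cast hT)
    linarith [Real.log_two_gt_d9]
  rw [← ENNReal.ofReal_pow (Real.exp_pos _).le, ← ENNReal.ofReal_natCast,
    ← ENNReal.ofReal_mul (Nat.cast_nonneg _), ← ENNReal.ofReal_mul (by positivity)]
  refine ENNReal.ofReal_le_ofReal ?_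
  have hmain : (T : ℝ) * (4 * (θ / 8) ^ 2 + θ / 8 * (2 * k / T)) +
      ((2 * (k : ℝ) ^ 2 + 7 * k) * Real.log T + -(θ / 8 * (T * θ))) ≤
      -((T : ℝ) * (θ / 12) ^ 2 / (16 * (k : ℝ))) + 10 * (k : ℝ) ^ 3 * Real.log T := by
    have e1 : (T : ℝ) * (θ / 8 * (2 * k / T)) = θ * k / 4 := by field_simp; ring
    have e2 : (T : ℝ) * (θ / 12) ^ 2 / (16 * (k : ℝ)) ≤ T * θ ^ 2 / 16 := by
      rw [div_le_div_iff₀ (by positivity) (by norm_num)]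
      have : 0 ≤ (T : ℝ) * θ ^ 2 := by positivity
      nlinarith
    have e3 : θ * k / 4 ≤ k * Real.log T := by nlinarith
    have e4 : (2 * (k : ℝ) ^ 2 + 8 * k) * Real.log T ≤ 10 * (k : ℝ) ^ 3 * Real.log T := by
      refine mul_le_mul_of_nonneg_right ?_ (by linarith)
      have h2 : (k : ℝ) ^ 2 ≤ (k : ℝ) ^ 3 := pow_le_pow_right₀ hk1 (by norm_num)
      have h1 : (k : ℝ) ≤ (k : ℝ) ^ 3 := le_self_pow₀ hk1 (by norm_num)
      linarith
    rw [mul_add, e1]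
    nlinarith
  calc Real.exp (4 * (θ / 8) ^ 2 + θ / 8 * (2 * k / T)) ^ T *
        ((Fintype.card (Expert k T) : ℝ) * Real.exp (-(θ / 8 * (T * θ))))
      ≤ Real.exp (4 * (θ / 8) ^ 2 + θ / 8 * (2 * k / T)) ^ T *
        (Real.exp ((2 * (k : ℝ) ^ 2 + 7 * k) * Real.log T) *
          Real.exp (-(θ / 8 * (T * θ)))) := by gcongr
    _ = Real.exp ((T : ℝ) * (4 * (θ / 8) ^ 2 + θ / 8 * (2 * k / T)) +
      ((2 * (k : ℝ) ^ 2 + 7 * k) * Real.log T + -(θ / 8 * (T * θ)))) := by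
        rw [← Real.exp_nat_mul, ← Real.exp_add, ← Real.exp_add]
    _ ≤ Real.exp _ := Real.exp_le_exp.2 hmain
    _ ≤ 8 * Real.exp _ := le_mul_of_one_le_left (Real.exp_pos _).le (by norm_num)

theorem thetaValue_le {k T : ℕ} (hk : 1 ≤ k) (hT : 2 ≤ T) {θ : ℝ} (hθ : 0 < θ) (hθ' : θ ≤ 2) :
    thetaValue k T θ ≤ ENNReal.ofReal (8 * Real.exp
      (-((T : ℝ) * (θ / 12) ^ 2 / (16 * (k : ℝ))) + 10 * (k : ℝ) ^ 3 * Real.log T)) := by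
  have hg := isContained_gain (k := k) (n := T) hk (by omega) (η := θ / 8) (by positivity)
    (by linarith)
  refine le_trans (gameValue_le_of_le_sum_prod hg ENNReal.ofReal_ne_top T
    (fun _ => ENNReal.ofReal (Real.exp (-(θ / 8 * (T * θ))))) _ fun h => ?_) ?_
  · rw [← Finset.mul_sum]
    rw [Set.indicator_apply]
    split_ifs with hh
    · exact one_le_mul_potential_of_lt_regret hk (by omega) (by positivity) hh
    · exact zero_le
  · rw [Finset.sum_const, nsmul_eq_mul, Finset.card_univ]
    exact growth_mul_card_mul_exp_le hk hT hθ hθ'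

theorem thetaValue_eq_zero {k T : ℕ} (hk : 1 ≤ k) {θ : ℝ} (hθ : 2 < θ) : thetaValue k T θ = 0 := by
  have hg := isContained_gain (k := k) (n := 1) hk one_pos le_rfl (by norm_num)
  refine le_antisymm ((gameValue_le_of_le_sum_prod hg ENNReal.ofReal_ne_top T 0 _
    fun h => ?_).trans (by simp)) zero_le
  rw [Set.indicator_of_notMem]
  · exact zero_le
  · simpa using (regret_le_two h).trans hθ.le

theorem exists_strategy_law_le {k T : ℕ} (hk : 1 ≤ k) (hT : 2 ≤ T) {θ : ℝ} (hθ : 0 < θ)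
    (hθ' : θ ≤ 2) :
    ∃ π : PlayerStrategy k, ∀ α : AdversaryStrategy k,
      law π α T {h | θ < regret h} ≤ ENNReal.ofReal (8 * Real.exp
        (-((T : ℝ) * (θ / 12) ^ 2 / (16 * (k : ℝ))) + 10 * (k : ℝ) ^ 3 * Real.log T)) := by
  have hg := isContained_gain (k := k) (n := T) hk (by omega) (η := θ / 8) (by positivity)
    (by linarith)
  have hm : ∀ e : Expert k T, Measurable (e.gain (θ / 8)) := fun e => e.measurable_gain _
  obtain ⟨π, hπ⟩ := exists_strategy_of_isContained hg hm (Expert.finite_range_gain _)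
  refine ⟨π, fun α => le_trans ?_ (growth_mul_card_mul_exp_le hk hT hθ hθ')⟩
  set C := ENNReal.ofReal (Real.exp (-(θ / 8 * (T * θ))))
  calc law π α T {h | θ < regret h}
      ≤ law π α T {h | 1 ≤ C * potential (fun e : Expert k T => e.gain (θ / 8)) h} :=
        measure_mono fun h hh =>
          one_le_mul_potential_of_lt_regret hk (by omega) (by positivity) hh
    _ ≤ ∫⁻ h, C * potential (fun e : Expert k T => e.gain (θ / 8)) h ∂(law π α T) := by
        simpa using mul_meas_ge_le_lintegral (μ := law π α T)
          ((measurable_potential hm T).const_mul C) 1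
    _ = C * ∫⁻ h, potential (fun e : Expert k T => e.gain (θ / 8)) h ∂(law π α T) :=
        lintegral_const_mul _ (measurable_potential hm T)
    _ ≤ C * (_ ^ T * Fintype.card (Expert k T)) := by
        gcongr
        exact lintegral_potential_law_le hm π hπ α T
    _ = _ := by ring

end Calibration

theorem mainTheorem11 :
    ∃ c : ℝ, 0 < c ∧
      (∀ (k T : ℕ) (θ : ℝ), 1 ≤ k → 1 ≤ T → 3 / (T : ℝ) < θ →
        Calibration.thetaValue k T θ ≤
          ENNReal.ofReal (8 * Real.exp
            (-((T : ℝ) * (θ / 12) ^ 2 / (16 * (k : ℝ))) + c * (k : ℝ) ^ 3 * Real.log T))) ∧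
      (∀ (k T : ℕ) (η : ℝ), 1 ≤ k → 3 ≤ T → 0 < η → η < 1 →
        ∃ π : Calibration.PlayerStrategy k, ∀ α : Calibration.AdversaryStrategy k,
          Calibration.law π α T
            {h : Calibration.History k T |
              48 * Real.sqrt (((k : ℝ) * Real.log (8 / η) + c * (k : ℝ) ^ 4 * Real.log T) / (T : ℝ))
                < Calibration.regret h} ≤ ENNReal.ofReal η) := by
  -- `10 k³` dominates the exponent `2 k² + 7 k` in the number of experts and the rounding error `k`.
  refine ⟨10, by norm_num, fun k T θ hk hT hθ => ?_, fun k T η hk hT hη hη1 => ?_⟩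
  · by_cases h2 : θ ≤ 2
    · have hT2 : 2 ≤ T := by
        by_contra! hlt
        obtain rfl : T = 1 := by omega
        norm_num at hθ
        linarith
      exact Calibration.thetaValue_le hk hT2 (lt_trans (by positivity) hθ) h2
    · rw [Calibration.thetaValue_eq_zero hk (not_le.1 h2)]
      exact zero_le
  · have hk0 : (0 : ℝ) < k := by positivity
    have hT0 : (0 : ℝ) < T := by positivity
    have hlogη : 0 < Real.log (8 / η) := Real.log_pos (by rw [lt_div_iff₀ hη]; linarith)
    have hlogT : 0 ≤ Real.log T := Real.log_natCast_nonneg T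
    set D : ℝ := (k * Real.log (8 / η) + 10 * (k : ℝ) ^ 4 * Real.log T) / T with hD
    have hD0 : 0 < D := by positivity
    by_cases h2 : 48 * Real.sqrt D ≤ 2
    · obtain ⟨π, hπ⟩ := Calibration.exists_strategy_law_le hk (by omega : 2 ≤ T)
        (by positivity : 0 < 48 * Real.sqrt D) h2
      refine ⟨π, fun α => (hπ α).trans (ENNReal.ofReal_le_ofReal (le_of_eq ?_))⟩
      -- The threshold is the one at which the tail bound equals `η`.
      have hexp : -((T : ℝ) * (48 * Real.sqrt D / 12) ^ 2 / (16 * (k : ℝ))) +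
          10 * (k : ℝ) ^ 3 * Real.log T = -Real.log (8 / η) := by
        have hsq : (48 * Real.sqrt D / 12) ^ 2 = 16 * D := by
          rw [div_pow, mul_pow, Real.sq_sqrt hD0.le]; ring
        rw [hsq, hD]
        field_simp
        ring
      rw [hexp, Real.exp_neg, Real.exp_log (by positivity)]
      field_simp
    · obtain ⟨π, -⟩ := Calibration.exists_strategy_law_le hk (by omega : 2 ≤ T) one_pos one_le_two
      refine ⟨π, fun α => ?_⟩
      have hempty : {h : Calibration.History k T | 48 * Real.sqrt D < Calibration.regret h} = ∅ :=
        Set.eq_empty_of_forall_notMem fun h hh =>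
          h2 (le_of_lt (lt_of_lt_of_le hh (Calibration.regret_le_two h)))
      rw [hempty, measure_empty]
      exact zero_le
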